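/- **Conventions.** A nondeterministic Büchi automaton (NBA) over a finite alphabet $\Sigma$ is $\mathcal A=(\Sigma,Q,q_0,\delta,F)$ with $Q$ finite, $q_0\in Q$, $\delta:Q\times\Sigma\to 2^Q$ and $F\subseteq Q$. A run on $w\in\Sigma^\omega$ starts in $q_0$ and follows $\delta$; it is accepting if some state of $F$ occurs infinitely often in it; $L(\mathcal A)$ is the set of words that have an accepting run, and $\mathcal A_q$ is $\mathcal A$ with initial state $q$. The transitions of $\mathcal A$ are the triples $(q,\sigma,q')$ with $q'\in\delta(q,\sigma)$. $\mathcal A$ is a *safety* automaton if $F=Q$, *strongly unambiguous* if every $\omega$-word has at most one run, and *separating* if $L(\mathcal A_p)\cap L(\mathcal A_q)=\emptyset$ for all states $p\ne q$. A finite MDP $\mathcal M$ over $\Sigma$ has finite sets of states $S$ and actions $\mathrm{Act}$ and a partial function $\mathrm{Prob}$ that assigns to $(s,m,\sigma)\in S\times\mathrm{Act}\times\Sigma$ a subdistribution over $S$ (emit $\sigma$ and move), with total mass at most $1$ for each $(s,m)$; an action $m$ is available in $s$ if $\mathrm{Prob}(s,m,\sigma)$ is defined for some $\sigma$, and every state has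 an available action. Missing mass leads to a rejecting sink. A strategy maps finite paths to distributions over the available actions. $\mathrm{PSem}(s_0)$ is the supremum, over the strategies, of the probability that $\mathcal M$, started in $s_0$, produces an infinite word in $L(\mathcal A)$. In the product $\mathcal M\times\mathcal A$ the strategy also resolves the nondeterminism of $\mathcal A$: when a letter $\sigma$ is produced, the current state $q$ of $\mathcal A$ is replaced by the chosen successor $q'$, which may depend on the past and on $\sigma$, and the mass is lost if $q'\notin\delta(q,\sigma)$. $\mathrm{PSyn}(s_0)$ is the supremum, over the strategies of the product, of the probability that the run of the product from $(s_0,q_0)$ is infinite and visits some state in $S\times F$ infinitely often. $\mathcal A$ is *good for MDPs (GfM)* if $\mathrm{PSyn}(s_0)=\mathrm{PSem}(s_0)$ for every finite MDP $\mathcal M$ and every initial state $s_0$. For $n\ge 1$ let $$\mathcal L_n^s=\{\,u\,1\,v\,\$^\omega : u\in\{0,1\}^*,\ v\in\{0,1\}^{n-1}\}\cup\{0,1\}^\omega$$ over the alphabet $\{0,1,\$\}$, and let $\mathcal S_n$ be the NBA with states $q_0,\dots,q_n$, all final, initial state $q_0$, and transitions $q_0\to q_0$ on $0,1$; $q_0\to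 q_1$ on $1$; $q_i\to q_{i+1}$ on $0,1$ for $1\le i<n$; and $q_n\to q_n$ on $\$$. **Statement.** (1) For every $n\ge 1$, $\mathcal S_n$ is a strongly unambiguous, separating safety automaton that recognises $\mathcal L_n^s$ and has $n+1$ states and $2n+2$ transitions, while every GfM automaton that recognises $\mathcal L_n^s$ has at least $2^n$ states. (2) Consequently, strongly unambiguous separating safety automata are exponentially more succinct than GfM automata: there is a constant $c>0$ such that, for all sufficiently large $m$, there is a strongly unambiguous, separating safety automaton $\mathcal A$ with at most $m$ states and at most $m$ transitions such that every GfM automaton that recognises $L(\mathcal A)$ has at least $2^{cm}$ states. In both parts the lower bound is also claimed for the automata that satisfy the GfM condition in the variant in which the successor $q'$ has to be chosen before $\sigma$ is drawn, that is, in which the actions of the product are the pairs $(m,q')$. -/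

import Mathlib

open MeasureTheory ProbabilityTheory Filter
open scoped ENNReal

noncomputable section

/-! ## Nondeterministic Büchi word automata -/

/-- A nondeterministic Büchi word automaton over the alphabet `α`, with a finite set of states. -/
structure NBA (α : Type) where
  State : Type
  [finite : Finite State]
  init : State
  δ : State → α → Set State
  F : Set State

namespace NBA

variable {α : Type}

instance (A : NBA α) : Finite A.State := A.finite

/-- The automaton `A_q`, with the initial state replaced by `q`. -/
def withInit (A : NBA α) (q : A.State) : NBA α where
  State := A.State
  init := q
  δ := A.δ
  F := A.F

/-- `r` is the sequence of states of a run of `A` on the `ω`-word `w`. -/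
def IsRun (A : NBA α) (w : ℕ → α) (r : ℕ → A.State) : Prop :=
  r 0 = A.init ∧ ∀ i, r (i + 1) ∈ A.δ (r i) (w i)

/-- Büchi acceptance: some final state occurs infinitely often. -/
def IsAccepting (A : NBA α) (r : ℕ → A.State) : Prop :=
  ∃ q ∈ A.F, ∃ᶠ i in atTop, r i = q

/-- The language of `ω`-words that have an accepting run. -/
def language (A : NBA α) : Set (ℕ → α) :=
  {w | ∃ r, A.IsRun w r ∧ A.IsAccepting r}

/-- A safety automaton: all states are final. -/
def IsSafety (A : NBA α) : Prop := ∀ q, q ∈ A.F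

/-- No `ω`-word has more than one run (accepting or not). -/
def IsStronglyUnambiguous (A : NBA α) : Prop :=
  ∀ w r r', A.IsRun w r → A.IsRun w r' → r = r'

/-- Different states have disjoint languages. -/
def IsSeparating (A : NBA α) : Prop :=
  ∀ p q : A.State, p ≠ q → Disjoint (A.withInit p).language (A.withInit q).language

def numStates (A : NBA α) : ℕ := Nat.card A.State

/-- The number of triples `(q, σ, q')` with `q' ∈ δ(q, σ)`. -/
def numTransitions (A : NBA α) : ℕ :=
  Set.ncard {t : A.State × α × A.State | t.2.2 ∈ A.δ t.1 t.2.1}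

end NBA

/-! ## Markov decision processes -/

/-- A finite transition-labelled Markov decision process. `dom s m σ` says that the partial function
`Prob(s, m, σ)` is defined, and `prob s m σ t` is then the probability that action `m` in state `s`
emits the letter `σ` and moves to `t`. Probability mass may be missing. -/
structure MDP (α : Type) where
  State : Type
  Act : Type
  [finite_state : Finite State]
  [finite_act : Finite Act]
  dom : State → Act → α → Prop
  prob : State → Act → α → State → ℝ≥0∞
  prob_of_not_dom : ∀ s m σ t, ¬ dom s m σ → prob s m σ t = 0
  prob_le_one : ∀ s m, ∑' σ, ∑' t, prob s m σ t ≤ 1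
  exists_dom : ∀ s, ∃ m σ, dom s m σ

namespace MDP

variable {α : Type}

instance (M : MDP α) : Finite M.State := M.finite_state
instance (M : MDP α) : Finite M.Act := M.finite_act

/-- The set `Act(s)` of actions that are available in `s`. -/
def available (M : MDP α) (s : M.State) : Set M.Act := {m | ∃ σ, M.dom s m σ}

/-- The finite path that starts in a given state `s₀` and then makes the listed moves
(action, letter, successor state) ends in this state. -/
def lastState (M : MDP α) (s₀ : M.State) (h : List (M.Act × α × M.State)) : M.State :=
  (h.getLast?.map fun e => e.2.2).getD s₀

/-- A (history-dependent, randomised) strategy: it maps a finite path, given by its initial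
state and its moves, to a distribution over the actions available in the last state. -/
structure Strategy (M : MDP α) where
  choose : M.State → List (M.Act × α × M.State) → PMF M.Act
  choose_available : ∀ s₀ h, (choose s₀ h).support ⊆ M.available (M.lastState s₀ h)

/-- What happens in one step: a move (action, letter, successor state), or `none` if the process has
been lost, through missing probability mass, to an implicit rejecting sink. -/
def Outcome (M : MDP α) : Type := Option (M.Act × α × M.State)

instance (M : MDP α) : MeasurableSpace M.Outcome := ⊤
instance (M : MDP α) : DiscreteMeasurableSpace M.Outcome := ⟨fun _ => trivial⟩
instance (M : MDP α) [Finite α] : Finite M.Outcome :=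
  inferInstanceAs (Finite (Option (M.Act × α × M.State)))

/-- The letter and successor state produced by action `m` in state `s`, the missing mass being put
on `none`. -/
def moveLaw (M : MDP α) (s : M.State) (m : M.Act) : PMF (Option (α × M.State)) :=
  ⟨fun o => o.elim (1 - ∑' e : α × M.State, M.prob s m e.1 e.2) fun e => M.prob s m e.1 e.2, by
    have h : ∑' e : α × M.State, M.prob s m e.1 e.2 ≤ 1 := by
      rw [ENNReal.tsum_prod (f := fun a b => M.prob s m a b)]
      exact M.prob_le_one s m
    rw [ENNReal.summable.hasSum_iff, ← (Equiv.optionEquivSumPUnit.{0} _).symm.tsum_eq,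
      ENNReal.summable.tsum_sum ENNReal.summable]
    simpa using add_tsub_cancel_of_le h⟩

/-- The distribution of the outcome of the next step after the moves `h` from `s₀`. -/
def stepLaw (M : MDP α) (s₀ : M.State) (μ : M.Strategy) (h : List (M.Act × α × M.State)) :
    PMF M.Outcome :=
  (μ.choose s₀ h).bind fun m =>
    (M.moveLaw (M.lastState s₀ h) m).map (Option.map fun e => (m, e.1, e.2))

/-- The transition kernel of the process: a lost process stays lost, and otherwise the next outcome
is drawn according to the moves made so far. -/
def stepKernel (M : MDP α) [Finite α] (s₀ : M.State) (μ : M.Strategy) (n : ℕ) :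
    Kernel (∀ _ : Finset.Iic n, M.Outcome) M.Outcome :=
  Kernel.ofFunOfCountable fun x =>
    match x ⟨n, Finset.mem_Iic.2 le_rfl⟩ with
    | none => Measure.dirac (α := M.Outcome) none
    | some _ =>
      (M.stepLaw s₀ μ (List.reduceOption
        (List.ofFn fun i : Fin (n + 1) =>
          x ⟨i, Finset.mem_Iic.2 (Nat.lt_succ_iff.1 i.2)⟩))).toMeasure

instance (M : MDP α) [Finite α] (s₀ : M.State) (μ : M.Strategy) (n : ℕ) :
    IsMarkovKernel (M.stepKernel s₀ μ n) := by
  refine ⟨fun x => ?_⟩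
  show IsProbabilityMeasure
    (match x ⟨n, Finset.mem_Iic.2 le_rfl⟩ with
    | none => Measure.dirac (α := M.Outcome) none
    | some _ =>
      (M.stepLaw s₀ μ (List.reduceOption
        (List.ofFn fun i : Fin (n + 1) =>
          x ⟨i, Finset.mem_Iic.2 (Nat.lt_succ_iff.1 i.2)⟩))).toMeasure)
  split
  · exact Measure.dirac.isProbabilityMeasure (α := M.Outcome)
  · exact PMF.toMeasure.isProbabilityMeasure (α := M.Outcome) _

/-- The probability measure `Pr_{s₀}^μ` that a strategy and an initial state induce on the infinite
sequences of outcomes (Ionescu-Tulcea). -/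
def runMeasure (M : MDP α) [Finite α] (s₀ : M.State) (μ : M.Strategy) :
    Measure (ℕ → M.Outcome) :=
  Kernel.trajMeasure (X := fun _ => M.Outcome) (M.stepLaw s₀ μ []).toMeasure (M.stepKernel s₀ μ)

/-- `x` is the infinite run with the moves `e 0, e 1, …`; in particular the process is never lost. -/
def IsInfiniteRun (M : MDP α) (x : ℕ → M.Outcome) (e : ℕ → M.Act × α × M.State) : Prop :=
  ∀ i, x i = some (e i)

/-- The semantic satisfaction probability of `A` in state `s₀`: the supremum, over the strategies, of
the probability that the word produced by the run is in the language of `A`. -/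
def PSem (M : MDP α) [Finite α] (A : NBA α) (s₀ : M.State) : ℝ≥0∞ :=
  ⨆ μ : M.Strategy, M.runMeasure s₀ μ
    {x | ∃ e, M.IsInfiniteRun x e ∧ (fun i => (e i).2.1) ∈ A.language}

/-! ### The product of an MDP with an automaton -/

open Classical in
/-- The product `M × A`. An action of the product is an action `m` of `M` together with a decision
`c : C` on how to move in `A`, where `next c σ` is the successor state that is proposed for the
letter `σ`. When `m` emits `σ`, then `A` moves from its current state `q` to `next c σ`, if
this state is in `δ(q, σ)`; otherwise the probability mass is lost. -/
def product (M : MDP α) (A : NBA α) {C : Type} [Finite C] [Nonempty C]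
    (next : C → α → A.State) : MDP α where
  State := M.State × A.State
  Act := M.Act × C
  dom s m σ := M.dom s.1 m.1 σ
  prob s m σ t :=
    if t.2 = next m.2 σ ∧ t.2 ∈ A.δ s.2 σ then M.prob s.1 m.1 σ t.1 else 0
  prob_of_not_dom s m σ t h := by simp [M.prob_of_not_dom s.1 m.1 σ t.1 h]
  prob_le_one s m := by
    refine le_trans (ENNReal.tsum_le_tsum fun σ => ?_) (M.prob_le_one s.1 m.1)
    rw [ENNReal.tsum_prod (f := fun a b =>
      if b = next m.2 σ ∧ b ∈ A.δ s.2 σ then M.prob s.1 m.1 σ a else 0)]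
    refine ENNReal.tsum_le_tsum fun t => ?_
    rw [tsum_eq_single (next m.2 σ) fun b hb => by simp [hb]]
    split <;> simp
  exists_dom s := by
    obtain ⟨m, σ, h⟩ := M.exists_dom s.1
    exact ⟨(m, Classical.arbitrary C), σ, h⟩

/-- The syntactic satisfaction probability: the supremum, over the strategies of the product, of the
probability that the run of the product satisfies the Büchi condition
`F^× = {(s, q) | q ∈ F}`. -/
def PSyn (M : MDP α) [Finite α] (A : NBA α) {C : Type} [Finite C] [Nonempty C]
    (next : C → α → A.State) (s₀ : M.State) : ℝ≥0∞ :=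
  ⨆ μ : (M.product A next).Strategy, (M.product A next).runMeasure (s₀, A.init) μ
    {x | ∃ e, (M.product A next).IsInfiniteRun x e ∧
      ∃ p : M.State × A.State, p.2 ∈ A.F ∧ ∃ᶠ i in atTop, (e i).2.2 = p}

end MDP

namespace NBA

variable {α : Type}

instance (A : NBA α) : Nonempty A.State := ⟨A.init⟩

/-- `A` is good for MDPs: in every finite MDP, the nondeterminism of `A` can be resolved on the
fly without loss. A decision in the product prescribes a successor state for each letter, so that
the successor may depend on the letter that has just been produced (and on the whole past, but
not on the future). -/
def IsGfM [Finite α] (A : NBA α) : Prop :=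
  ∀ (M : MDP α) (s₀ : M.State), M.PSyn A (C := α → A.State) (fun f σ => f σ) s₀ = M.PSem A s₀

/-- The more restrictive variant in which the actions of the product are pairs `(m, q')`, so that the
successor state `q'` has to be fixed before the letter is drawn. -/
def IsGfMCommitted [Finite α] (A : NBA α) : Prop :=
  ∀ (M : MDP α) (s₀ : M.State), M.PSyn A (C := A.State) (fun q' _ => q') s₀ = M.PSem A s₀

/-- The automata in the class `P` are exponentially more succinct than those in the class `R`: for
`m` large enough, a translation into `R` takes some automaton in `P` with at most `m` states and
at most `m` transitions to an automaton with at least `2 ^ (c * m)` states. -/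
def ExponentiallyMoreSuccinct (P R : NBA α → Prop) : Prop :=
  ∃ c : ℝ, 0 < c ∧ ∀ᶠ m : ℕ in atTop, ∃ A : NBA α, P A ∧ A.numStates ≤ m ∧ A.numTransitions ≤ m ∧
    ∀ B : NBA α, R B → B.language = A.language → (2 : ℝ) ^ (c * m) ≤ B.numStates

end NBA

/-! ## The witnesses -/

/-- The alphabet `{0, 1, $}`. -/
inductive Letter
  | zero
  | one
  | dollar
  deriving DecidableEq

instance : Finite Letter :=
  Finite.of_surjective (fun i : Fin 3 => [Letter.zero, Letter.one, Letter.dollar].get i)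
    (by rintro (_ | _ | _); exacts [⟨0, rfl⟩, ⟨1, rfl⟩, ⟨2, rfl⟩])

/-- The finite words `{0,1}* 1 {0,1}^{n-1} $`, for `n ≥ 1`. -/
def langFin (n : ℕ) : Set (List Letter) :=
  {w | ∃ u v : List Letter, Letter.dollar ∉ u ∧ Letter.dollar ∉ v ∧ v.length = n - 1 ∧
    w = u ++ [Letter.one] ++ v ++ [Letter.dollar]}

/-- The concatenation of a finite word and an `ω`-word. -/
def appendWord {α : Type} (w : List α) (x : ℕ → α) : ℕ → α :=
  fun i => if h : i < w.length then w[i] else x (i - w.length)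

/-- The `ω`-language `{w $^ω | w ∈ langFin n} ∪ {0,1}^ω`. -/
def langSafe (n : ℕ) : Set (ℕ → Letter) :=
  {x | ∃ w ∈ langFin n, x = appendWord w fun _ => Letter.dollar} ∪ {x | ∀ i, x i ≠ Letter.dollar}

/-- The safety automaton with states `q_0, …, q_n` and the transitions: `q_0` to itself on `0, 1`;
`q_0` to `q_1` on `1`; `q_i` to `q_{i+1}` on `0, 1`, for `1 ≤ i < n`; `q_n` to itself on `$`. -/
def autS (n : ℕ) : NBA Letter where
  State := Fin (n + 1)
  init := 0
  δ q σ := {p |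
    (q.val = 0 ∧ p.val = 0 ∧ σ ≠ Letter.dollar) ∨
    (q.val = 0 ∧ p.val = 1 ∧ σ = Letter.one) ∨
    (1 ≤ q.val ∧ p.val = q.val + 1 ∧ σ ≠ Letter.dollar) ∨
    (q.val = n ∧ p.val = n ∧ σ = Letter.dollar)}
  F := Set.univ

end

/-! A word `b` of `n` bits followed by `0^t $^ω`, with `t < n`, is in the language if and only if
bit `t` of `b` is `1`: the block of `$` starts at position `t + n`, so the letter that must be `1`
is at position `t`. A nondeterministic automaton guesses this position, but a GfM automaton cannot
do so.

Consider the Markov chain that emits `b` and then draws `t` uniformly among the positions of the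
ones of `b`. All its words are in the language, so `PSem` is one. In the product, the state of the
automaton after `b` is fixed before `t` is drawn. If every reachable state rejected some relevant
continuation, each strategy would lose at least `1 / k`, where `k` is the number of ones, and `PSyn`
would be less than one. So some state reachable on `b` accepts `0^t $^ω` for all ones `t` of `b`
(`exists_state_of_isGfM`). If `b` and `b'` share such a state, putting `b'` before the continuations
for `b` shows that every one of `b` is a one of `b'`, and conversely. Hence there are at least `2 ^
n` states (`two_pow_le_numStates`).

The chain's letter is determined by the state that it leaves, so letting the successor depend on the
letter gives no advantage; one argument covers both variants of GfM. The probabilistic input is a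
uniform bound on one step of the process (`runMeasure_le`), together with almost sure properties of
runs. -/

namespace ProbabilityTheory.Kernel

/-! ### Marginals of the Ionescu-Tulcea measure. -/

variable {X : ℕ → Type*} [∀ n, MeasurableSpace (X n)]
  {κ : (n : ℕ) → Kernel (∀ i : Finset.Iic n, X i) (X (n + 1))} [∀ n, IsMarkovKernel (κ n)]
  {μ₀ : Measure (X 0)}

/-- The trajectory kernel from time 0 does not alter coordinate 0. The map `g` stands for the
identification of `X 0` with one-coordinate families inside `trajMeasure`. -/
theorem map_eval_zero_traj_comp {g : X 0 → ∀ i : Finset.Iic 0, X i} (hg : Measurable g)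
    (h : ∀ y, g y ⟨0, Finset.mem_Iic.2 le_rfl⟩ = y) :
    (traj κ 0 ∘ₘ (μ₀.map g)).map (fun x => x 0) = μ₀ := by
  have h1 : (traj κ 0 ∘ₘ (μ₀.map g)).map (Preorder.frestrictLe 0) = μ₀.map g := by
    rw [Measure.map_comp _ _ (by fun_prop), traj_map_frestrictLe, partialTraj_self,
      Measure.id_comp]
  have h2 := congrArg (Measure.map fun y => y ⟨0, Finset.mem_Iic.2 le_rfl⟩) h1
  rw [Measure.map_map (by fun_prop) (by fun_prop), Measure.map_map (by fun_prop) hg] at h2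
  exact h2.trans ((congrArg (fun f => μ₀.map f) (funext h)).trans Measure.map_id)

theorem trajMeasure_map_eval_zero : (trajMeasure μ₀ κ).map (fun x => x 0) = μ₀ :=
  map_eval_zero_traj_comp (MeasurableEquiv.measurable _) fun _ => rfl

/-- The joint law of the past and the next coordinate is a composition product with `κ a`, so a
bound on the conditional probability that is uniform in the past survives integration. -/
theorem trajMeasure_pair_le [IsProbabilityMeasure μ₀] {a : ℕ}
    {T : Set ((∀ i : Finset.Iic a, X i) × X (a + 1))}
    (hT : MeasurableSet T) {c : ℝ≥0∞} (h : ∀ x, κ a x (Prod.mk x ⁻¹' T) ≤ c) :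
    trajMeasure μ₀ κ {x | (Preorder.frestrictLe a x, x (a + 1)) ∈ T} ≤ c := by
  have hm : Measurable fun x : ∀ n, X n => (Preorder.frestrictLe (π := X) a x, x (a + 1)) := by
    fun_prop
  have hp : IsProbabilityMeasure ((trajMeasure μ₀ κ).map (Preorder.frestrictLe a)) :=
    Measure.isProbabilityMeasure_map (by fun_prop)
  calc trajMeasure μ₀ κ {x | (Preorder.frestrictLe a x, x (a + 1)) ∈ T}
      = (trajMeasure μ₀ κ).map (fun x => (Preorder.frestrictLe a x, x (a + 1))) T :=
        (Measure.map_apply hm hT).symm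
    _ = ∫⁻ x, κ a x (Prod.mk x ⁻¹' T) ∂((trajMeasure μ₀ κ).map (Preorder.frestrictLe a)) := by
        rw [← map_frestrictLe_trajMeasure_compProd_eq_map_trajMeasure, Measure.compProd_apply hT]
    _ ≤ ∫⁻ _, c ∂((trajMeasure μ₀ κ).map (Preorder.frestrictLe a)) := lintegral_mono h
    _ = c := by simp

end ProbabilityTheory.Kernel

/-! ### Runs of an MDP: one-step bounds and almost sure properties. -/

namespace MDP

variable {α : Type} (M : MDP α) (s₀ : M.State) (μ : M.Strategy)

/-- The moves made up to time `n`. -/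
def movesUpTo (n : ℕ) (x : ∀ _ : Finset.Iic n, M.Outcome) : List (M.Act × α × M.State) :=
  List.reduceOption (List.ofFn fun i : Fin (n + 1) =>
    x ⟨i, Finset.mem_Iic.2 (Nat.lt_succ_iff.1 i.2)⟩)

variable {M} in
theorem lastState_movesUpTo {n : ℕ} {x : ∀ _ : Finset.Iic n, M.Outcome}
    {e : M.Act × α × M.State} (h : x ⟨n, Finset.mem_Iic.2 le_rfl⟩ = some e) :
    M.lastState s₀ (M.movesUpTo n x) = e.2.2 := by
  have key : ∀ f : Fin (n + 1) → Option (M.Act × α × M.State), f (Fin.last n) = some e →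
      M.lastState s₀ (List.ofFn f).reduceOption = e.2.2 := by
    intro f hf
    rw [List.ofFn_succ', List.concat_eq_append, List.reduceOption_append, hf,
      List.reduceOption_singleton]
    simp [lastState]
  exact key _ h

theorem stepKernel_of_none [Finite α] {n : ℕ} {x : ∀ _ : Finset.Iic n, M.Outcome}
    (h : x ⟨n, Finset.mem_Iic.2 le_rfl⟩ = none) :
    M.stepKernel s₀ μ n x = Measure.dirac (α := M.Outcome) none := by
  show (match x ⟨n, Finset.mem_Iic.2 le_rfl⟩ with
    | none => Measure.dirac (α := M.Outcome) none
    | some _ => (M.stepLaw s₀ μ (M.movesUpTo n x)).toMeasure) = _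
  rw [h]

theorem stepKernel_of_some [Finite α] {n : ℕ} {x : ∀ _ : Finset.Iic n, M.Outcome}
    {e : M.Act × α × M.State} (h : x ⟨n, Finset.mem_Iic.2 le_rfl⟩ = some e) :
    M.stepKernel s₀ μ n x = (M.stepLaw s₀ μ (M.movesUpTo n x)).toMeasure := by
  show (match x ⟨n, Finset.mem_Iic.2 le_rfl⟩ with
    | none => Measure.dirac (α := M.Outcome) none
    | some _ => (M.stepLaw s₀ μ (M.movesUpTo n x)).toMeasure) = _
  rw [h]

instance : IsProbabilityMeasure (M.stepLaw s₀ μ []).toMeasure :=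
  PMF.toMeasure.isProbabilityMeasure (α := M.Outcome) _

instance [Finite α] : IsProbabilityMeasure (M.runMeasure s₀ μ) := by
  unfold runMeasure; infer_instance

theorem runMeasure_zero [Finite α] (S : Set M.Outcome) :
    M.runMeasure s₀ μ {x | x 0 ∈ S} = (M.stepLaw s₀ μ []).toOuterMeasure S := by
  have h := Kernel.trajMeasure_map_eval_zero (X := fun _ => M.Outcome)
    (κ := M.stepKernel s₀ μ) (μ₀ := (M.stepLaw s₀ μ []).toMeasure)
  have h2 := congrArg (fun m : Measure M.Outcome => m S) h
  rw [Measure.map_apply (by fun_prop) (MeasurableSet.of_discrete)] at h2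
  refine Eq.trans h2 ?_
  exact PMF.toMeasure_apply_eq_toOuterMeasure_apply _ (MeasurableSet.of_discrete (s := S))

/-- A lost process stays at `none`, which `hnone` keeps out of the target, so only `stepLaw`
matters. The target may depend on the past, so that an outcome can be compared with the state before
it. -/
theorem runMeasure_succ_le [Finite α] {n : ℕ} {T : (∀ _ : Finset.Iic n, M.Outcome) → Set M.Outcome}
    {c : ℝ≥0∞} (hnone : ∀ x, x ⟨n, Finset.mem_Iic.2 le_rfl⟩ = none → none ∉ T x)
    (h : ∀ x e, x ⟨n, Finset.mem_Iic.2 le_rfl⟩ = some e →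
      (M.stepLaw s₀ μ (M.movesUpTo n x)).toOuterMeasure (T x) ≤ c) :
    M.runMeasure s₀ μ {x | x (n + 1) ∈ T (Preorder.frestrictLe n x)} ≤ c := by
  have := Kernel.trajMeasure_pair_le (X := fun _ => M.Outcome)
    (κ := M.stepKernel s₀ μ) (μ₀ := (M.stepLaw s₀ μ []).toMeasure) (a := n)
    (T := {p | p.2 ∈ T p.1}) (c := c) MeasurableSet.of_discrete fun x => ?_
  · exact this
  · change M.stepKernel s₀ μ n x (T x) ≤ c
    rcases hx : x ⟨n, Finset.mem_Iic.2 le_rfl⟩ with _ | e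
    · have h0 := Measure.dirac_apply' (α := M.Outcome) none (MeasurableSet.of_discrete (s := T x))
      have h1 : (T x).indicator (1 : M.Outcome → ℝ≥0∞) none = 0 :=
        Set.indicator_of_notMem (hnone x hx) _
      rw [stepKernel_of_none _ _ _ hx]
      exact (h0.trans h1).trans_le bot_le
    · rw [stepKernel_of_some _ _ _ hx,
        PMF.toMeasure_apply_eq_toOuterMeasure_apply _ (MeasurableSet.of_discrete (s := T x))]
      exact h x e hx

/-- If every action, in every state, hits `S` with probability at most `c`, then the probability
that the process hits `S` at a given time is at most `c`. -/
theorem runMeasure_le [Finite α] {S : Set M.Outcome} {c : ℝ≥0∞} (hnone : none ∉ S)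
    (h : ∀ s m, (M.moveLaw s m).toOuterMeasure ((Option.map fun e => (m, e.1, e.2)) ⁻¹' S) ≤ c)
    (n : ℕ) : M.runMeasure s₀ μ {x | x n ∈ S} ≤ c := by
  have hstep : ∀ l, (M.stepLaw s₀ μ l).toOuterMeasure S ≤ c := by
    intro l
    rw [stepLaw, PMF.toOuterMeasure_bind_apply]
    calc _ ≤ ∑' m, (μ.choose s₀ l) m * c := by
          refine ENNReal.tsum_le_tsum fun m => ?_
          gcongr
          exact (PMF.toOuterMeasure_map_apply (β := M.Outcome) _ _ _).trans_le (h _ _)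
      _ = c := by rw [ENNReal.tsum_mul_right, PMF.tsum_coe, one_mul]
  cases n with
  | zero => rw [runMeasure_zero]; exact hstep _
  | succ n =>
    exact runMeasure_succ_le M s₀ μ (T := fun _ => S) (fun _ _ => hnone) fun x e _ => hstep _

variable {M} in
/-- `o` is a possible outcome of a move from `s`. -/
def IsPossible (s : M.State) (o : M.Outcome) : Prop :=
  ∃ m, ∃ o' : Option (α × M.State), M.moveLaw s m o' ≠ 0 ∧ o'.map (fun e => (m, e.1, e.2)) = o

variable {M s₀ μ} in
theorem isPossible_of_stepLaw {l : List (M.Act × α × M.State)} {o : M.Outcome}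
    (h : M.stepLaw s₀ μ l o ≠ 0) : IsPossible (M.lastState s₀ l) o := by
  rw [stepLaw, ← PMF.mem_support_iff, PMF.mem_support_bind_iff] at h
  obtain ⟨m, -, hm⟩ := h
  obtain ⟨o', h1, h2⟩ := (PMF.mem_support_map_iff (β := M.Outcome) _ _ _).1 hm
  exact ⟨m, o', h1, h2⟩

/-- An impossible outcome has probability zero at each fixed time, by `runMeasure_succ_le` with `c =
0` after time 0, and there are countably many times. -/
theorem ae_isPossible [Finite α] : ∀ᵐ x ∂M.runMeasure s₀ μ, IsPossible s₀ (x 0) ∧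
    ∀ n e, x n = some e → IsPossible e.2.2 (x (n + 1)) := by
  rw [eventually_and]
  constructor
  · have := runMeasure_zero M s₀ μ {o | ¬ IsPossible s₀ o}
    rw [ae_iff]
    refine this.trans ?_
    rw [PMF.toOuterMeasure_apply_eq_zero_iff, Set.disjoint_left]
    intro o ho hn
    exact hn (isPossible_of_stepLaw ho)
  · rw [ae_all_iff]
    intro n
    have := runMeasure_succ_le M s₀ μ (n := n) (c := 0)
      (T := fun x => {o | ∃ e, x ⟨n, Finset.mem_Iic.2 le_rfl⟩ = some e ∧ ¬ IsPossible e.2.2 o})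
      (fun x hx => by rintro ⟨e, he, -⟩; rw [hx] at he; cases he) fun x e hx => ?_
    · rw [ae_iff]
      refine le_antisymm (le_trans (le_of_eq ?_) this) bot_le
      congr 1
      ext x
      show (¬ ∀ e, x n = some e → IsPossible e.2.2 (x (n + 1))) ↔
        ∃ e, x n = some e ∧ ¬ IsPossible e.2.2 (x (n + 1))
      simp only [not_forall, exists_prop]
    · rw [nonpos_iff_eq_zero, PMF.toOuterMeasure_apply_eq_zero_iff, Set.disjoint_left]
      rintro o ho ⟨e', he', hn⟩
      apply hn
      rw [← lastState_movesUpTo s₀ he']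
      exact isPossible_of_stepLaw ho

/-- Almost surely, all the moves of an infinite run have positive probability. -/
theorem ae_prob_ne_zero [Finite α] : ∀ᵐ x ∂M.runMeasure s₀ μ, ∀ e, M.IsInfiniteRun x e →
    ∃ s : ℕ → M.State, s 0 = s₀ ∧
      ∀ i, s (i + 1) = (e i).2.2 ∧ M.prob (s i) (e i).1 (e i).2.1 (s (i + 1)) ≠ 0 := by
  have key : ∀ s e, IsPossible (M := M) s (some e) → M.prob s e.1 e.2.1 e.2.2 ≠ 0 := by
    rintro s e ⟨m, o', h1, h2⟩
    cases o' with
    | none => cases h2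
    | some p =>
      obtain rfl := Option.some.inj h2
      exact h1
  filter_upwards [M.ae_isPossible s₀ μ] with x hx e he
  -- The move `e i` leads from `s i` to `s (i + 1)`, so the states are shifted by one against the
  -- moves.
  refine ⟨fun i => i.casesOn s₀ fun j => (e j).2.2, rfl, fun i => ⟨rfl, key _ _ ?_⟩⟩
  cases i with
  | zero => exact he 0 ▸ hx.1
  | succ i => exact he (i + 1) ▸ hx.2 i _ (he i)

/-- If no probability mass is missing, then almost all runs are infinite. -/
theorem ae_isInfiniteRun [Finite α]
    (h : ∀ s m, ∑' e : α × M.State, M.prob s m e.1 e.2 = 1) :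
    ∀ᵐ x ∂M.runMeasure s₀ μ, ∃ e, M.IsInfiniteRun x e := by
  have key : ∀ s, ¬ IsPossible (M := M) s none := by
    rintro s ⟨m, o', h1, h2⟩
    cases o' with
    | none =>
      apply h1
      show 1 - ∑' e : α × M.State, M.prob s m e.1 e.2 = 0
      rw [h, tsub_self]
    | some p => cases h2
  filter_upwards [M.ae_isPossible s₀ μ] with x hx
  have hex : ∀ i, ∃ e, x i = some e := by
    intro i
    induction i with
    | zero =>
      rcases h0 : x 0 with _ | e
      · exact absurd (h0 ▸ hx.1) (key s₀)
      · exact ⟨e, rfl⟩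
    | succ i ih =>
      obtain ⟨e, he⟩ := ih
      rcases h1 : x (i + 1) with _ | e'
      · exact absurd (h1 ▸ hx.2 i e he) (key _)
      · exact ⟨e', rfl⟩
  exact ⟨fun i => (hex i).choose, fun i => (hex i).choose_spec⟩

theorem runMeasure_eq_one [Finite α] {p : (ℕ → M.Outcome) → Prop}
    (h : ∀ᵐ x ∂M.runMeasure s₀ μ, p x) : M.runMeasure s₀ μ {x | p x} = 1 := by
  rw [measure_congr (eventuallyEq_univ.2 h), measure_univ]

/-- If the runs in `E` are in a state in `B` after `n + 1` moves, and if every action hits `B` with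
probability at most `c`, then `E` has probability at most `c`. -/
theorem runMeasure_le_of_hits [Finite α] {E : Set (ℕ → M.Outcome)} {B : Set M.State} {c : ℝ≥0∞}
    (n : ℕ) (hE : ∀ x ∈ E, ∃ e, M.IsInfiniteRun x e ∧ ∀ s : ℕ → M.State, s 0 = s₀ →
      (∀ i, s (i + 1) = (e i).2.2 ∧ M.prob (s i) (e i).1 (e i).2.1 (s (i + 1)) ≠ 0) →
      s (n + 1) ∈ B)
    (hB : ∀ s m, (M.moveLaw s m).toOuterMeasure {o | ∃ σ t, o = some (σ, t) ∧ t ∈ B} ≤ c) :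
    M.runMeasure s₀ μ E ≤ c := by
  let B' : Set M.Outcome := {o | ∃ m σ t, o = some (m, σ, t) ∧ t ∈ B}
  have hsub : E ≤ᵐ[M.runMeasure s₀ μ] {x | x n ∈ B'} := by
    filter_upwards [M.ae_prob_ne_zero s₀ μ] with x hx hxE
    obtain ⟨e, he, h⟩ := hE x hxE
    obtain ⟨s, hs0, hs⟩ := hx e he
    exact ⟨(e n).1, (e n).2.1, (e n).2.2, he n, (hs n).1 ▸ h s hs0 hs⟩
  have hnone : none ∉ B' := by
    rintro ⟨m, σ, t, h0, -⟩
    cases h0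
  refine (measure_mono_ae hsub).trans (M.runMeasure_le s₀ μ hnone (fun s m => ?_) n)
  refine le_trans (measure_mono ?_) (hB s m)
  rintro o ⟨m', σ, t, h1, h2⟩
  cases o with
  | none => cases h1
  | some p =>
    have h3 := Option.some.inj h1
    simp only [Prod.mk.injEq] at h3
    obtain ⟨-, rfl, rfl⟩ := h3
    exact ⟨_, _, rfl, h2⟩

end MDP

theorem PMF.toOuterMeasure_compl_singleton {T : Type*} (p : PMF T) (a : T) :
    p.toOuterMeasure {a}ᶜ = 1 - p a := by
  classical
  refine ENNReal.eq_sub_of_add_eq (p.apply_ne_top a) ?_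
  rw [← p.tsum_coe, ENNReal.tsum_eq_add_tsum_ite a, add_comm, PMF.toOuterMeasure_apply]
  congr 1
  refine tsum_congr fun t => ?_
  by_cases h : t = a <;> simp [h]

/-- Comparison of masses along an injection `g` whose range contains the support of `f` in `E`. It
serves to bound a move of the product by the move of the chain alone. -/
theorem PMF.tsum_indicator_le_toOuterMeasure {O S : Type*} (f : O → ℝ≥0∞) (E : Set O) {g : S → O}
    (hg : g.Injective) (p : PMF S) (D : Set S) (hE : ∀ o ∈ E, f o ≠ 0 → o ∈ Set.range g)
    (hD : ∀ u, g u ∈ E → u ∈ D ∧ f (g u) ≤ p u) :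
    ∑' o, E.indicator f o ≤ p.toOuterMeasure D := by
  rw [← hg.tsum_eq, PMF.toOuterMeasure_apply]
  · refine ENNReal.tsum_le_tsum fun u => ?_
    by_cases hu : g u ∈ E
    · rw [Set.indicator_of_mem hu, Set.indicator_of_mem (hD u hu).1]
      exact (hD u hu).2
    · simp [hu]
  · intro o ho
    rw [Function.mem_support, Set.indicator_apply_ne_zero] at ho
    exact hE o ho.1 ho.2

/-- The `ω`-word that agrees with `w` before time `n`, and then continues with `y`. -/
def splice {α : Type} (n : ℕ) (w y : ℕ → α) : ℕ → α :=
  fun i => if i < n then w i else y (i - n)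

/-! ### Markov chains as MDPs, and their products with automata. -/

namespace MDP

open Classical in
/-- The Markov chain with transition probabilities `nxt` that emits `letter s` whenever it leaves the
state `s`. -/
noncomputable def ofChain {α S : Type} [Finite S] (letter : S → α) (nxt : S → PMF S) : MDP α where
  State := S
  Act := Unit
  dom s _ σ := σ = letter s
  prob s _ σ t := if σ = letter s then nxt s t else 0
  prob_of_not_dom s _ σ t h := by simp [h]
  prob_le_one s _ := by
    rw [tsum_eq_single (letter s) fun σ hσ => by simp [hσ]]
    simp [PMF.tsum_coe]
  exists_dom s := ⟨(), letter s, rfl⟩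

section Chain

variable {α S : Type} [Finite S] {letter : S → α} {nxt : S → PMF S}

theorem ofChain_tsum (s : S) (m : Unit) :
    ∑' e : α × S, (ofChain letter nxt).prob s m e.1 e.2 = 1 := by
  have := ENNReal.tsum_prod (f := fun a b => (ofChain letter nxt).prob s m a b)
  refine Eq.trans this ?_
  rw [tsum_eq_single (letter s) fun σ hσ => by simp [ofChain, hσ]]
  simp only [ofChain, if_true]
  exact PMF.tsum_coe (nxt s)

theorem ofChain_prob_ne_zero {s t : S} {m : Unit} {σ : α}
    (h : (ofChain letter nxt).prob s m σ t ≠ 0) : σ = letter s ∧ nxt s t ≠ 0 := by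
  by_cases hσ : σ = letter s
  · exact ⟨hσ, by simpa [ofChain, hσ] using h⟩
  · simp [ofChain, hσ] at h

/-- If all the words that the chain can produce are in the language, then the semantic satisfaction
probability is one. -/
theorem one_le_PSem_ofChain [Finite α] (A : NBA α) (s₀ : S)
    (h : ∀ s : ℕ → S, s 0 = s₀ → (∀ i, nxt (s i) (s (i + 1)) ≠ 0) →
      (fun i => letter (s i)) ∈ A.language) :
    1 ≤ (ofChain letter nxt).PSem A s₀ := by
  set M := ofChain letter nxt
  let μ : M.Strategy := ⟨fun _ _ => PMF.pure (), fun s₀ l m _ => ⟨letter (M.lastState s₀ l), rfl⟩⟩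
  refine le_trans (ge_of_eq (M.runMeasure_eq_one s₀ μ ?_)) (le_iSup
    (fun μ => M.runMeasure s₀ μ {x | ∃ e, M.IsInfiniteRun x e ∧
      (fun i => (e i).2.1) ∈ A.language}) μ)
  filter_upwards [M.ae_prob_ne_zero s₀ μ, M.ae_isInfiniteRun s₀ μ ofChain_tsum] with x hx ⟨e, he⟩
  obtain ⟨s, hs0, hs⟩ := hx e he
  refine ⟨e, he, ?_⟩
  have hword : (fun i => (e i).2.1) = fun i => letter (s i) :=
    funext fun i => (ofChain_prob_ne_zero (hs i).2).1
  rw [hword]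
  exact h s hs0 fun i => (ofChain_prob_ne_zero (hs i).2).2

theorem product_ofChain_prob_ne_zero (A : NBA α) {C : Type} [Finite C] [Nonempty C]
    {next : C → α → A.State} {s t : S × A.State} {m : Unit × C} {σ : α}
    (h : ((ofChain letter nxt).product A next).prob s m σ t ≠ 0) :
    t.2 = next m.2 σ ∧ t.2 ∈ A.δ s.2 σ ∧ σ = letter s.1 ∧ nxt s.1 t.1 ≠ 0 := by
  by_cases hc : t.2 = next m.2 σ ∧ t.2 ∈ A.δ s.2 σ
  · have h' : (ofChain letter nxt).prob s.1 m.1 σ t.1 ≠ 0 := by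
      intro h0
      exact h ((if_pos hc).trans h0)
    exact ⟨hc.1, hc.2, ofChain_prob_ne_zero h'⟩
  · exact absurd (if_neg hc) h

/-- In the product with a chain, the successor state of the automaton is fixed before the successor
state of the chain is drawn. -/
theorem product_ofChain_moveLaw_le (A : NBA α) {C : Type} [Finite C] [Nonempty C]
    (next : C → α → A.State) (s : S × A.State) (m : Unit × C) {c : ℝ≥0∞}
    {D : A.State → Set S} (hD : ∀ s q, (nxt s).toOuterMeasure (D q) ≤ c) :
    (((ofChain letter nxt).product A next).moveLaw s m).toOuterMeasure
      {o | ∃ σ t, o = some (σ, t) ∧ t.1 ∈ D t.2} ≤ c := by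
  classical
  -- The emitted letter is a function of the state being left, so the action already determines the
  -- successor in the automaton and only `u` is random.
  let g : S → Option (α × (S × A.State)) :=
    fun u => some (letter s.1, (u, next m.2 (letter s.1)))
  refine le_trans (le_of_eq (PMF.toOuterMeasure_apply _ _)) (le_trans ?_
    (hD s.1 (next m.2 (letter s.1))))
  refine PMF.tsum_indicator_le_toOuterMeasure (g := g) _ _ (fun u v h => ?_) _ _ ?_ ?_
  · simpa [g] using h
  · rintro o ⟨σ, t, rfl, -⟩ ho
    obtain ⟨h1, -, rfl, -⟩ := product_ofChain_prob_ne_zero A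
      (show ((ofChain letter nxt).product A next).prob s m σ t ≠ 0 from ho)
    exact ⟨t.1, congrArg (fun q => some (letter s.1, (t.1, q))) h1.symm⟩
  · rintro u ⟨σ, t, h1, h2⟩
    obtain rfl := congrArg (fun p => p.2) (Option.some.inj h1)
    refine ⟨h2, ?_⟩
    show (if _ ∧ _ then (if letter s.1 = letter s.1 then nxt s.1 u else 0) else 0) ≤ _
    split_ifs <;> simp

/-- Suppose that, at time `n`, a run of the product with a chain can satisfy the Büchi condition only if
the state of the chain is in `D q`, where `q` is the state of the automaton, and that `D q` is always
hit with probability at most `c`. Then the syntactic satisfaction probability is at most `c`. -/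
theorem PSyn_ofChain_le [Finite α] (A : NBA α) {C : Type} [Finite C] [Nonempty C]
    (next : C → α → A.State) (s₀ : S) {c : ℝ≥0∞} {D : A.State → Set S}
    (hD : ∀ s q, (nxt s).toOuterMeasure (D q) ≤ c) (n : ℕ)
    (h : ∀ (s : ℕ → S) (r : ℕ → A.State), s 0 = s₀ → (∀ i, nxt (s i) (s (i + 1)) ≠ 0) →
      A.IsRun (fun i => letter (s i)) r → A.IsAccepting r → s (n + 1) ∈ D (r (n + 1))) :
    (ofChain letter nxt).PSyn A next s₀ ≤ c := by
  refine iSup_le fun μ => ?_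
  refine runMeasure_le_of_hits _ _ μ (B := {t : S × A.State | t.1 ∈ D t.2}) n ?_
    fun s m => product_ofChain_moveLaw_le A next s m hD
  rintro x ⟨e, he, p, hpF, hp⟩
  refine ⟨e, he, fun s hs0 hs => ?_⟩
  have hs' := fun i => product_ofChain_prob_ne_zero A (hs i).2
  refine h (fun i => (s i).1) (fun i => (s i).2) (congrArg Prod.fst hs0)
    (fun i => (hs' i).2.2.2) ⟨congrArg Prod.snd hs0, fun i => ?_⟩ ⟨p.2, hpF, ?_⟩
  · have h1 := (hs' i).2.1
    rw [(hs' i).2.2.1] at h1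
    exact h1
  · rw [frequently_atTop] at hp ⊢
    intro a
    obtain ⟨b, hb, hb'⟩ := hp a
    -- The Büchi condition of `PSyn` looks at the targets of the moves, and the target of move `b`
    -- is the state at time `b + 1`.
    exact ⟨b + 1, by omega, congrArg Prod.snd ((hs b).1.trans hb')⟩

end Chain

end MDP

/-! ### The branching chain and its consequence for GfM automata. -/

namespace NBA

section Branching

variable {α T : Type} {n : ℕ} (w : ℕ → α) (emit : T → α) (step : T → T) (ρ : PMF T)

/-- The letters emitted by the chain that first emits `w 0, …, w n`, then draws a state from `ρ`, and
then follows `step`. The Boolean marks the states that have just been drawn. -/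
def branchLetter : Fin (n + 1) ⊕ (Bool × T) → α :=
  Sum.elim (fun j => w j) fun t => emit t.2

/-- The transition law of the chain that first emits `w 0, …, w n`, then draws a state from `ρ`, and
then follows `step`. -/
noncomputable def branchNext : Fin (n + 1) ⊕ (Bool × T) → PMF (Fin (n + 1) ⊕ (Bool × T)) :=
  Sum.elim
    (fun j => if h : j.1 + 1 < n + 1 then PMF.pure (Sum.inl ⟨j.1 + 1, h⟩)
      else ρ.map fun t => Sum.inr (true, t))
    fun t => PMF.pure (Sum.inr (false, step t.2))

variable {w emit step ρ}

/-- The draw on leaving state `n` is the only random transition, so the drawn `t` determines the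
whole path and its word. -/
theorem branch_path {s : ℕ → Fin (n + 1) ⊕ (Bool × T)} (h0 : s 0 = Sum.inl 0)
    (hs : ∀ i, branchNext step ρ (s i) (s (i + 1)) ≠ 0) :
    ∃ t, ρ t ≠ 0 ∧ s (n + 1) = Sum.inr (true, t) ∧
      (fun i => branchLetter w emit (s i)) = splice (n + 1) w fun k => emit (step^[k] t) := by
  have h1 : ∀ j (hj : j < n + 1), s j = Sum.inl ⟨j, hj⟩ := by
    intro j
    induction j with
    | zero => intro _; exact h0
    | succ j ih =>
      intro hj
      have := hs j
      rw [ih (by omega)] at this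
      simpa [branchNext, Nat.lt_of_succ_lt_succ hj] using this
  obtain ⟨t, ht, hst⟩ : ∃ t, ρ t ≠ 0 ∧ s (n + 1) = Sum.inr (true, t) := by
    have := hs n
    rw [h1 n (by omega), ← PMF.mem_support_iff] at this
    simp only [branchNext, Sum.elim_inl, lt_self_iff_false, dite_false,
      PMF.mem_support_map_iff] at this
    obtain ⟨t, ht, hst⟩ := this
    exact ⟨t, ht, hst.symm⟩
  have h2 : ∀ k, ∃ b, s (n + 1 + k) = Sum.inr (b, step^[k] t) := by
    intro k
    induction k with
    | zero => exact ⟨true, hst⟩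
    | succ k ih =>
      obtain ⟨b, hb⟩ := ih
      have := hs (n + 1 + k)
      rw [hb] at this
      refine ⟨false, ?_⟩
      rw [Function.iterate_succ_apply']
      simpa [branchNext, ← add_assoc] using this
  refine ⟨t, ht, hst, funext fun i => ?_⟩
  by_cases hi : i < n + 1
  · simp [splice, hi, h1 i hi, branchLetter]
  · obtain ⟨b, hb⟩ := h2 (i - (n + 1))
    rw [show n + 1 + (i - (n + 1)) = i by omega] at hb
    simp [splice, hi, hb, branchLetter]

/-- The mark `true` makes the bound valid from every state: the deterministic steps after the draw
lead to `false` and never hit the set. -/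
theorem branchNext_hits_le {c : ℝ≥0∞} (a : T) (h : 1 - ρ a ≤ c) (s : Fin (n + 1) ⊕ (Bool × T)) :
    (branchNext step ρ s).toOuterMeasure {u | ∃ t, u = Sum.inr (true, t) ∧ t ≠ a} ≤ c := by
  rcases s with j | t
  · by_cases hj : j.1 + 1 < n + 1
    · simp only [branchNext, Sum.elim_inl, hj, dite_true, PMF.toOuterMeasure_pure_apply]
      simp
    · simp only [branchNext, Sum.elim_inl, hj, dite_false, PMF.toOuterMeasure_map_apply]
      refine le_trans (le_of_eq ?_) ((PMF.toOuterMeasure_compl_singleton ρ a).trans_le h)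
      congr 1
      ext t
      simp
  · simp [branchNext, PMF.toOuterMeasure_pure_apply]

/-- If `A` is good for MDPs and accepts all the words that consist of `w 0 ⋯ w n` and one of
finitely many continuations, then it has a run on `w 0 ⋯ w n` to a state that accepts
all these continuations. -/
theorem exists_state_of_isGfM [Finite α] [Finite T] {A : NBA α} (hA : A.IsGfM ∨ A.IsGfMCommitted)
    (n : ℕ) (w : ℕ → α) (emit : T → α) (step : T → T) {ρ : Finset T} (hρ : ρ.Nonempty)
    (hL : ∀ t ∈ ρ, splice (n + 1) w (fun k => emit (step^[k] t)) ∈ A.language) :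
    ∃ r : ℕ → A.State, r 0 = A.init ∧ (∀ i < n + 1, r (i + 1) ∈ A.δ (r i) (w i)) ∧
      ∀ t ∈ ρ, (fun k => emit (step^[k] t)) ∈ (A.withInit (r (n + 1))).language := by
  by_contra! hbad
  -- Each state gets a continuation that it rejects; for a state not reachable on the prefix, any
  -- element of `ρ` serves.
  have hbad' : ∀ q : A.State, ∃ t ∈ ρ, ∀ r : ℕ → A.State, r 0 = A.init →
      (∀ i < n + 1, r (i + 1) ∈ A.δ (r i) (w i)) → r (n + 1) = q →
      (fun k => emit (step^[k] t)) ∉ (A.withInit q).language := by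
    intro q
    by_cases hq : ∃ r : ℕ → A.State, r 0 = A.init ∧
        (∀ i < n + 1, r (i + 1) ∈ A.δ (r i) (w i)) ∧ r (n + 1) = q
    · obtain ⟨r, h0, h1, rfl⟩ := hq
      obtain ⟨t, ht, h2⟩ := hbad r h0 h1
      exact ⟨t, ht, fun _ _ _ _ => h2⟩
    · obtain ⟨t, ht⟩ := hρ
      exact ⟨t, ht, fun r h0 h1 h2 => absurd ⟨r, h0, h1, h2⟩ hq⟩
  choose bad hbadρ hbadL using hbad'
  let p := PMF.uniformOfFinset ρ hρ
  let M : MDP α := MDP.ofChain (branchLetter (n := n) w emit) (branchNext step p)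
  have hsem : 1 ≤ M.PSem A (Sum.inl (0 : Fin (n + 1))) := by
    refine MDP.one_le_PSem_ofChain A _ fun s hs0 hs => ?_
    obtain ⟨t, ht, -, hw⟩ := branch_path (w := w) (emit := emit) hs0 hs
    rw [hw]
    exact hL t ((PMF.mem_support_uniformOfFinset_iff hρ t).1 ht)
  -- A successful run must avoid the bad continuation of its state, which is drawn with probability
  -- `1 / ρ.card`.
  set c : ℝ≥0∞ := 1 - (ρ.card : ℝ≥0∞)⁻¹ with hc
  have hc1 : c < 1 := by
    refine ENNReal.sub_lt_self ENNReal.one_ne_top one_ne_zero ?_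
    simp
  have hsyn : ∀ {C : Type} [Finite C] [Nonempty C] (next : C → α → A.State),
      M.PSyn A next (Sum.inl (0 : Fin (n + 1))) ≤ c := by
    intro C _ _ next
    refine MDP.PSyn_ofChain_le A next _
      (D := fun q => {u | ∃ t, u = Sum.inr (true, t) ∧ t ≠ bad q})
      (fun s q => branchNext_hits_le _ ?_ s) n fun s r hs0 hs hr hacc => ?_
    · rw [PMF.uniformOfFinset_apply_of_mem hρ (hbadρ q)]
    · obtain ⟨t, ht, hst, hw⟩ := branch_path (w := w) (emit := emit) hs0 hs
      rw [hw] at hr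
      refine ⟨t, hst, ?_⟩
      -- If the bad continuation is drawn, the tail of an accepting run would accept it from `r (n +
      -- 1)`.
      rintro rfl
      refine hbadL (r (n + 1)) r hr.1 (fun i hi => ?_) rfl
        ⟨fun k => r (n + 1 + k), ⟨rfl, fun k => ?_⟩, ?_⟩
      · have := hr.2 i
        simpa [splice, hi] using this
      · have h1 := hr.2 (n + 1 + k)
        have h2 : ∀ w y : ℕ → α, splice (n + 1) w y (n + 1 + k) = y k := fun w y => by
          simp [splice, show ¬ n + 1 + k ≤ n by omega]
        rw [h2] at h1
        exact h1
      · obtain ⟨q, hqF, hq⟩ := hacc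
        refine ⟨q, hqF, ?_⟩
        rw [frequently_atTop] at hq ⊢
        intro a
        obtain ⟨b, hb, hb'⟩ := hq (n + 1 + a)
        refine ⟨b - (n + 1), by omega, ?_⟩
        show r (n + 1 + (b - (n + 1))) = q
        rw [show n + 1 + (b - (n + 1)) = b by omega, hb']
  rcases hA with h | h
  · exact absurd ((hsem.trans_eq (h M _).symm).trans (hsyn _)) hc1.not_ge
  · exact absurd ((hsem.trans_eq (h M _).symm).trans (hsyn _)) hc1.not_ge

end Branching

/-- In a safety automaton, every run is accepting. -/
theorem IsSafety.isAccepting {α : Type} {A : NBA α} (hA : A.IsSafety) (r : ℕ → A.State) :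
    A.IsAccepting r := by
  obtain ⟨q, hq⟩ := Finite.exists_infinite_fiber r
  refine ⟨q, hA q, Nat.frequently_atTop_iff_infinite.2 ?_⟩
  exact Set.infinite_coe_iff.1 hq

/-- A separating safety automaton is strongly unambiguous. -/
theorem IsSeparating.isStronglyUnambiguous {α : Type} {A : NBA α} (hA : A.IsSeparating)
    (hF : A.IsSafety) : A.IsStronglyUnambiguous := by
  intro w r r' hr hr'
  funext i
  by_contra h
  have key : ∀ r : ℕ → A.State, A.IsRun w r →
      (fun k => w (i + k)) ∈ (A.withInit (r i)).language := fun r hr =>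
    ⟨fun k => r (i + k), ⟨rfl, fun k => hr.2 (i + k)⟩,
      IsSafety.isAccepting (A := A.withInit (r i)) hF _⟩
  exact Set.disjoint_left.1 (hA _ _ h) (key r hr) (key r' hr')

end NBA

/-! ### The safety language by positions. -/

theorem appendWord_concat_const {α : Type} (p : List α) (a : α) (j : ℕ) :
    appendWord (p ++ [a]) (fun _ => a) j = if h : j < p.length then p[j] else a := by
  by_cases h : j < p.length
  · have h' : j < (p ++ [a]).length := by simp; omega
    simp [appendWord, h, show j < p.length + 1 by omega]
  · by_cases h' : j < p.length + 1 <;> simp [appendWord, h, h', List.getElem_append]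

/-- A word is in `langSafe n` if and only if it contains no `$`, or if it consists of `m + n` letters
`0` and `1`, of which the one at position `m` is `1`, followed by `$^ω`. -/
theorem mem_langSafe_iff {n : ℕ} (hn : 1 ≤ n) {x : ℕ → Letter} :
    x ∈ langSafe n ↔ (∀ i, x i ≠ Letter.dollar) ∨ ∃ m, (∀ j < m + n, x j ≠ Letter.dollar) ∧
      (∀ j, m + n ≤ j → x j = Letter.dollar) ∧ x m = Letter.one := by
  rw [langSafe, Set.mem_union, or_comm]
  refine or_congr Iff.rfl ⟨?_, ?_⟩
  · rintro ⟨w, ⟨u, v, hu, hv, hlen, rfl⟩, rfl⟩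
    have hp : (u ++ [Letter.one] ++ v).length = u.length + n := by simp; omega
    have hpd : Letter.dollar ∉ u ++ [Letter.one] ++ v := by simp [hu, hv]
    refine ⟨u.length, fun j hj => ?_, fun j hj => ?_, ?_⟩
    · rw [appendWord_concat_const, dif_pos (hp ▸ hj)]
      exact fun h => hpd (h ▸ List.getElem_mem _)
    · rw [appendWord_concat_const, dif_neg (by omega)]
    · rw [appendWord_concat_const, dif_pos (by omega)]
      simp
  · rintro ⟨m, h1, h2, h3⟩
    refine ⟨_, ⟨List.ofFn fun i : Fin m => x i, List.ofFn fun i : Fin (n - 1) => x (m + 1 + i),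
      ?_, ?_, by simp, rfl⟩, funext fun j => ?_⟩
    · rw [List.mem_ofFn]
      rintro ⟨i, hi⟩
      exact h1 i (by omega) hi
    · rw [List.mem_ofFn]
      rintro ⟨i, hi⟩
      exact h1 _ (by omega) hi
    · rw [appendWord_concat_const]
      split_ifs with h
      · simp only [List.length_append, List.length_ofFn, List.length_singleton] at h
        rcases lt_trichotomy j m with hj | rfl | hj
        · simp [hj]
        · simp [h3]
        · rw [List.getElem_append_right (by simp; omega)]
          simp [show m + 1 + (j - (m + 1)) = j by omega]
      · simp only [List.length_append, List.length_ofFn, List.length_singleton] at h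
        exact h2 j (by omega)

/-! ### The automaton with `n + 1` states. -/

section AutS

variable {n : ℕ} {x : ℕ → Letter} {r : ℕ → Fin (n + 1)}

/-- Outside `q_0` the automaton is a counter that saturates at `n`, so its present value fixes where
the `$` begin. -/
theorem autS_steps_tail (hr : ∀ i, r (i + 1) ∈ (autS n).δ (r i) (x i)) {a : ℕ}
    (ha : 1 ≤ (r a).val) (k : ℕ) :
    (k < n - r a → x (a + k) ≠ Letter.dollar) ∧ (n - r a ≤ k → x (a + k) = Letter.dollar) := by
  have hval : ∀ k, (r (a + k)).val = min (r a + k) n := by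
    intro k
    induction k with
    | zero => have := (r a).isLt; simp only [add_zero]; omega
    | succ k ih =>
      have h1 := (r (a + (k + 1))).isLt
      have h2 := (r (a + k)).isLt
      rcases hr (a + k) with h | h | h | h <;> rw [← add_assoc] at * <;> omega
  have hk := hval k
  have hk' := hval (k + 1)
  rw [← add_assoc] at hk'
  have := (r a).isLt
  constructor
  · intro h
    rcases hr (a + k) with h' | h' | h' | h'
    · exact h'.2.2
    · simp [h'.2.2]
    · exact h'.2.2
    · omega
  · intro h
    rcases hr (a + k) with h' | h' | h' | h'
    · omega
    · omega
    · omega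
    · exact h'.2.2

theorem autS_steps_zero (hr : ∀ i, r (i + 1) ∈ (autS n).δ (r i) (x i)) (hn : 1 ≤ n)
    (h0 : (r 0).val = 0) :
    (∀ i, x i ≠ Letter.dollar) ∨ ∃ m, (∀ j < m + n, x j ≠ Letter.dollar) ∧
      (∀ j, m + n ≤ j → x j = Letter.dollar) ∧ x m = Letter.one := by
  by_cases h : ∃ i, (r (i + 1)).val ≠ 0
  · right
    classical
    -- The run leaves `q_0` while reading letter `m`, which must be `1`.
    set m := Nat.find h with hm
    have hm1 : (r (m + 1)).val ≠ 0 := Nat.find_spec h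
    have hlt : ∀ i, i ≤ m → (r i).val = 0 := by
      intro i hi
      cases i with
      | zero => exact h0
      | succ i => exact not_not.1 (Nat.find_min h (show i < m by omega))
    have hstep := hr m
    have hrm := hlt m le_rfl
    have hone : (r (m + 1)).val = 1 ∧ x m = Letter.one := by
      rcases hstep with h' | h' | h' | h'
      · omega
      · exact h'.2
      · omega
      · omega
    have htail := autS_steps_tail hr (a := m + 1) (by omega)
    rw [hone.1] at htail
    refine ⟨m, fun j hj => ?_, fun j hj => ?_, hone.2⟩
    · rcases lt_trichotomy j m with hj' | rfl | hj'
      · have h1 := hlt j hj'.le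
        have h2 := hlt (j + 1) hj'
        rcases hr j with h' | h' | h' | h'
        · exact h'.2.2
        · omega
        · omega
        · omega
      · simp [hone.2]
      · have := (htail (j - (m + 1))).1 (by omega)
        rwa [show m + 1 + (j - (m + 1)) = j by omega] at this
    · have := (htail (j - (m + 1))).2 (by omega)
      rwa [show m + 1 + (j - (m + 1)) = j by omega] at this
  · left
    push Not at h
    intro i
    have h1 := h i
    rcases hr i with h' | h' | h' | h'
    · exact h'.2.2
    · omega
    · omega
    · omega

theorem autS_isSafety (n : ℕ) : (autS n).IsSafety := fun _ => trivial

theorem autS_language (hn : 1 ≤ n) : (autS n).language = langSafe n := by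
  ext x
  rw [mem_langSafe_iff hn]
  constructor
  · rintro ⟨r, ⟨h0, hr⟩, -⟩
    exact autS_steps_zero (n := n) hr hn (congrArg Fin.val h0)
  · rintro (h | ⟨m, h1, h2, h3⟩)
    · exact ⟨fun _ => (0 : Fin (n + 1)), ⟨rfl, fun i => Or.inl ⟨rfl, rfl, h i⟩⟩,
        (autS_isSafety n).isAccepting _⟩
    -- Truncated subtraction keeps the run in `q_0` up to time `m`; the minimum keeps it in `q_n`
    -- from time `m + n` on.
    · refine ⟨fun i => (⟨min (i - m) n, by omega⟩ : Fin (n + 1)), ⟨?_, fun i => ?_⟩,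
        (autS_isSafety n).isAccepting _⟩
      · exact Fin.ext (by simp [autS])
      · show (min (i - m) n = 0 ∧ min (i + 1 - m) n = 0 ∧ x i ≠ Letter.dollar) ∨
          (min (i - m) n = 0 ∧ min (i + 1 - m) n = 1 ∧ x i = Letter.one) ∨
          (1 ≤ min (i - m) n ∧ min (i + 1 - m) n = min (i - m) n + 1 ∧ x i ≠ Letter.dollar) ∨
          (min (i - m) n = n ∧ min (i + 1 - m) n = n ∧ x i = Letter.dollar)
        rcases lt_trichotomy i m with hi | rfl | hi
        · exact Or.inl ⟨by omega, by omega, h1 i (by omega)⟩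
        · exact Or.inr (Or.inl ⟨by omega, by omega, h3⟩)
        · by_cases hin : i < m + n
          · exact Or.inr (Or.inr (Or.inl ⟨by omega, by omega, h1 i hin⟩))
          · exact Or.inr (Or.inr (Or.inr ⟨by omega, by omega, h2 i (by omega)⟩))

/-- The first `$` reveals the state: from `q_i` with `i ≥ 1` it is at position `n - i < n`, and from
`q_0` there is none before position `n`. -/
theorem autS_isSeparating (hn : 1 ≤ n) : (autS n).IsSeparating := by
  have hz : ∀ (x : ℕ → Letter) (r : ℕ → Fin (n + 1)), (∀ i, r (i + 1) ∈ (autS n).δ (r i) (x i)) →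
      (r 0).val = 0 → ∀ j < n, x j ≠ Letter.dollar := by
    intro x r hr h0 j hj
    rcases autS_steps_zero hr hn h0 with h | ⟨m, h, -⟩
    · exact h j
    · exact h j (by omega)
  have hp : ∀ (x : ℕ → Letter) (r : ℕ → Fin (n + 1)), (∀ i, r (i + 1) ∈ (autS n).δ (r i) (x i)) →
      1 ≤ (r 0).val → (∀ j < n - (r 0).val, x j ≠ Letter.dollar) ∧
        x (n - (r 0).val) = Letter.dollar := by
    intro x r hr h0
    have := autS_steps_tail hr h0
    simp only [zero_add] at this
    exact ⟨fun j => (this j).1, (this _).2 le_rfl⟩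
  intro p q hpq
  rw [Set.disjoint_left]
  rintro x ⟨r, ⟨h0, hr⟩, -⟩ ⟨r', ⟨h0', hr'⟩, -⟩
  have hv : (r 0).val = p.val := congrArg Fin.val h0
  have hv' : (r' 0).val = q.val := congrArg Fin.val h0'
  have hne : p.val ≠ q.val := fun h => hpq (Fin.ext h)
  have hp1 := p.isLt
  have hq1 := q.isLt
  rcases Nat.eq_zero_or_pos p.val with hp0 | hp0 <;> rcases Nat.eq_zero_or_pos q.val with hq0 | hq0
  · omega
  · exact hz x r hr (hv.trans hp0) _ (by omega) (hp x r' hr' (by omega)).2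
  · exact hz x r' hr' (hv'.trans hq0) _ (by omega) (hp x r hr (by omega)).2
  · rcases lt_or_gt_of_ne hne with h | h
    · exact (hp x r hr (by omega)).1 _ (by omega) (hp x r' hr' (by omega)).2
    · exact (hp x r' hr' (by omega)).1 _ (by omega) (hp x r hr (by omega)).2

theorem autS_numTransitions (hn : 1 ≤ n) : (autS n).numTransitions = 2 * n + 2 := by
  -- Each `q_i` with `i < n` has a loop (`i = 0`) or a forward step (`i ≥ 1`) on both bits, which
  -- gives `2 * n`; the guess `q_0 → q_1` and the loop on `$` are the other two.
  let f : (Fin n × Bool) ⊕ Bool → Fin (n + 1) × Letter × Fin (n + 1)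
    | Sum.inl (i, b) => (i.castSucc, if b then Letter.one else Letter.zero,
        if i.val = 0 then 0 else i.succ)
    | Sum.inr true => (0, Letter.one, ⟨1, by omega⟩)
    | Sum.inr false => (Fin.last n, Letter.dollar, Fin.last n)
  have hf : f.Injective := by
    rintro (⟨i, b⟩ | b) (⟨i', b'⟩ | b') h
    · have h1 : i = i' := Fin.castSucc_injective n (congrArg Prod.fst h)
      have h2 : (if b then Letter.one else Letter.zero) = if b' then Letter.one else Letter.zero :=
        congrArg (fun t => t.2.1) h
      subst h1
      cases b <;> cases b' <;> simp_all
    · cases b' <;> cases b <;> simp [f, Fin.ext_iff] at h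
      split_ifs at h <;> simp at h
      omega
    · cases b' <;> cases b <;> simp [f, Fin.ext_iff] at h
      split_ifs at h <;> simp at h
      omega
    · cases b <;> cases b' <;> simp_all [f]
  have hS : ∀ (q p : Fin (n + 1)) (σ : Letter),
      p ∈ (autS n).δ q σ ↔ (q, σ, p) ∈ Set.range f := by
    intro q p σ
    constructor
    · rintro (h | h | h | h)
      · refine ⟨Sum.inl (⟨0, hn⟩, σ = Letter.one),
          Prod.ext (Fin.ext h.1.symm) (Prod.ext ?_ (Fin.ext h.2.1.symm))⟩
        cases σ <;> simp_all [f]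
      · exact ⟨Sum.inr true,
          Prod.ext (Fin.ext h.1.symm) (Prod.ext h.2.2.symm (Fin.ext h.2.1.symm))⟩
      · have hq : q.val < n := by have := p.isLt; omega
        refine ⟨Sum.inl (⟨q.val, hq⟩, σ = Letter.one), ?_⟩
        cases σ <;> simp_all [f, Fin.ext_iff, show q.val ≠ 0 by omega]
      · exact ⟨Sum.inr false,
          Prod.ext (Fin.ext h.1.symm) (Prod.ext h.2.2.symm (Fin.ext h.2.1.symm))⟩
    · rintro ⟨⟨i, b⟩ | b, h⟩
      · simp only [f, Prod.mk.injEq] at h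
        obtain ⟨rfl, rfl, rfl⟩ := h
        by_cases hi : i.val = 0
        · exact Or.inl ⟨hi, by simp [hi], by cases b <;> simp⟩
        · exact Or.inr (Or.inr (Or.inl ⟨Nat.one_le_iff_ne_zero.2 hi, by simp [hi],
            by cases b <;> simp⟩))
      · cases b <;> simp only [f, Prod.mk.injEq] at h <;> obtain ⟨rfl, rfl, rfl⟩ := h
        · exact Or.inr (Or.inr (Or.inr ⟨rfl, rfl, rfl⟩))
        · exact Or.inr (Or.inl ⟨rfl, rfl, rfl⟩)
  have hS' : {t : (autS n).State × Letter × (autS n).State | t.2.2 ∈ (autS n).δ t.1 t.2.1}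
      = Set.range f := Set.ext fun t => hS t.1 t.2.2 t.2.1
  rw [NBA.numTransitions, hS']
  refine (Nat.card_coe_set_eq _).symm.trans ((Nat.card_range_of_injective hf).trans ?_)
  simp
  omega

theorem autS_numStates (n : ℕ) : (autS n).numStates = n + 1 :=
  Nat.card_fin (n + 1)

end AutS

/-! ### The lower bound of `2 ^ n` states. -/

theorem splice_of_lt {α : Type} {n i : ℕ} (w y : ℕ → α) (h : i < n) : splice n w y i = w i :=
  if_pos h

theorem splice_add {α : Type} (n k : ℕ) (w y : ℕ → α) : splice n w y (n + k) = y k := by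
  simp [splice]

/-- The word `0^t $^ω`. -/
def zerosDollars (t k : ℕ) : Letter := if k < t then Letter.zero else Letter.dollar

/-- The finite word over `{0,1}` that is given by the Booleans `b`, followed by `0^ω`. -/
def bitWord {n : ℕ} (b : Fin n → Bool) (i : ℕ) : Letter :=
  if h : i < n then (if b ⟨i, h⟩ then Letter.one else Letter.zero) else Letter.zero

theorem bitWord_ne_dollar {n : ℕ} (b : Fin n → Bool) (i : ℕ) : bitWord b i ≠ Letter.dollar := by
  unfold bitWord
  split_ifs <;> simp

/-- The `$` begin exactly at `t + n`, which forces the distinguished position to be `t`. -/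
theorem splice_zerosDollars_mem_langSafe_iff {n : ℕ} (b : Fin n → Bool) (t : Fin n) :
    splice n (bitWord b) (zerosDollars t) ∈ langSafe n ↔ b t := by
  have hlt : ∀ j < t.val + n, splice n (bitWord b) (zerosDollars t) j ≠ Letter.dollar := by
    intro j hj
    by_cases hjn : j < n
    · rw [splice_of_lt _ _ hjn]
      exact bitWord_ne_dollar b j
    · rw [← Nat.add_sub_cancel' (not_lt.1 hjn), splice_add]
      simp [zerosDollars, show j - n < t by omega]
  have hge : ∀ j, t.val + n ≤ j → splice n (bitWord b) (zerosDollars t) j = Letter.dollar := by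
    intro j hj
    rw [← Nat.add_sub_cancel' (show n ≤ j by omega), splice_add]
    simp [zerosDollars, show ¬ j - n < t by omega]
  have hone : splice n (bitWord b) (zerosDollars t) t = Letter.one ↔ b t := by
    rw [splice_of_lt _ _ t.isLt]
    simp [bitWord]
  rw [mem_langSafe_iff (by have := t.isLt; omega), ← hone]
  constructor
  · rintro (h | ⟨m, h1, h2, h3⟩)
    · exact absurd (hge _ le_rfl) (h _)
    · have hm : m = t.val := by
        rcases lt_trichotomy m t with h | h | h
        · exact absurd (h2 (m + n) le_rfl) (hlt _ (by omega))
        · exact h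
        · exact absurd (hge (t.val + n) le_rfl) (h1 _ (by omega))
      rwa [hm] at h3
  · exact fun h => Or.inr ⟨t, hlt, hge, h⟩

namespace NBA

theorem mem_language_of_prefix {α : Type} {A : NBA α} {n : ℕ} {w y : ℕ → α} {r : ℕ → A.State}
    (h0 : r 0 = A.init) (hr : ∀ i < n, r (i + 1) ∈ A.δ (r i) (w i))
    (hy : y ∈ (A.withInit (r n)).language) : splice n w y ∈ A.language := by
  obtain ⟨r', ⟨h0', hr'⟩, q, hqF, hq⟩ := hy
  have hadd : ∀ k, splice n r r' (n + k) = r' k := fun k => splice_add n k r r'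
  have hle : ∀ i ≤ n, splice n r r' i = r i := by
    intro i hi
    rcases hi.lt_or_eq with h | rfl
    · exact splice_of_lt _ _ h
    · exact (hadd 0).trans h0'
  refine ⟨splice n r r', ⟨(hle 0 (Nat.zero_le n)).trans h0, fun i => ?_⟩, q, hqF, ?_⟩
  · by_cases hi : i < n
    · rw [hle i hi.le, hle (i + 1) hi, splice_of_lt _ _ hi]
      exact hr i hi
    · obtain ⟨k, rfl⟩ := Nat.exists_eq_add_of_le (not_lt.1 hi)
      rw [add_assoc, hadd, hadd, splice_add]
      exact hr' k
  · rw [frequently_atTop] at hq ⊢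
    intro a
    obtain ⟨k, hk, hk'⟩ := hq a
    exact ⟨n + k, by omega, (hadd k).trans hk'⟩

/-- Every GfM automaton for `langSafe n` has at least `2 ^ n` states. -/
theorem two_pow_le_numStates {n : ℕ} (hn : 1 ≤ n) {B : NBA Letter}
    (hB : B.IsGfM ∨ B.IsGfMCommitted) (hL : B.language = langSafe n) : 2 ^ n ≤ B.numStates := by
  have key : ∀ b : Fin n → Bool, ∃ r : ℕ → B.State, r 0 = B.init ∧
      (∀ i < n, r (i + 1) ∈ B.δ (r i) (bitWord b i)) ∧
      ∀ t : Fin n, b t → zerosDollars t ∈ (B.withInit (r n)).language := by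
    intro b
    by_cases hb : ∃ t, b t
    · obtain ⟨N, rfl⟩ := Nat.exists_eq_add_of_le' hn
      -- A countdown from `t` that emits `0` until it reaches zero and `$` from then on produces
      -- `0^t $^ω`.
      let emit : Fin (N + 1) → Letter := fun t => if t.val = 0 then Letter.dollar else Letter.zero
      let step : Fin (N + 1) → Fin (N + 1) := fun t => ⟨t.val - 1, by omega⟩
      have hiter : ∀ t k, ((step^[k] t : Fin (N + 1)) : ℕ) = t.val - k := by
        intro t k
        induction k with
        | zero => rfl
        | succ k ih =>
          rw [Function.iterate_succ_apply']
          show (step^[k] t : Fin (N + 1)).val - 1 = _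
          omega
      have hword : ∀ t, (fun k => emit (step^[k] t)) = zerosDollars t.val := by
        intro t
        funext k
        simp only [emit, hiter, zerosDollars, Nat.sub_eq_zero_iff_le]
        by_cases h : k < t.val
        · rw [if_neg (by omega), if_pos h]
        · rw [if_pos (by omega), if_neg h]
      obtain ⟨r, h0, h1, h2⟩ := exists_state_of_isGfM hB N (bitWord b) emit step
        (ρ := Finset.univ.filter fun t => b t) (hb.imp fun t ht => by simpa using ht)
        fun t ht => by
          rw [hword, hL, splice_zerosDollars_mem_langSafe_iff]
          simpa using ht
      exact ⟨r, h0, h1, fun t ht => hword t ▸ h2 t (by simpa using ht)⟩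
    -- For the zero word there is nothing to draw and a run on the prefix suffices; it exists
    -- because `{0,1}^ω` is part of the language.
    · have hmem : bitWord b ∈ B.language := by
        rw [hL, mem_langSafe_iff hn]
        exact Or.inl (bitWord_ne_dollar b)
      obtain ⟨r, ⟨h0, hr⟩, -⟩ := hmem
      exact ⟨r, h0, fun i _ => hr i, fun t ht => absurd ⟨t, ht⟩ hb⟩
  choose r h0 h1 h2 using key
  have himp : ∀ b b' : Fin n → Bool, r b n = r b' n → ∀ t, b t → b' t := by
    intro b b' h t ht
    rw [← splice_zerosDollars_mem_langSafe_iff, ← hL]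
    exact mem_language_of_prefix (h0 b') (h1 b') (h ▸ h2 b t ht)
  have hinj : Function.Injective fun b : Fin n → Bool => r b n := fun b b' h =>
    funext fun t => Bool.eq_iff_iff.2 ⟨himp b b' h t, himp b' b h.symm t⟩
  have := Nat.card_le_card_of_injective _ hinj
  simpa [numStates] using this

end NBA

theorem mainTheorem6 :
    (∀ n : ℕ, 1 ≤ n →
      (autS n).IsStronglyUnambiguous ∧ (autS n).IsSeparating ∧ (autS n).IsSafety ∧
      (autS n).language = langSafe n ∧
      (autS n).numStates = n + 1 ∧ (autS n).numTransitions = 2 * n + 2 ∧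
      ∀ B : NBA Letter, B.IsGfM ∨ B.IsGfMCommitted → B.language = langSafe n →
        2 ^ n ≤ B.numStates) ∧
    NBA.ExponentiallyMoreSuccinct
      (fun A : NBA Letter => A.IsStronglyUnambiguous ∧ A.IsSeparating ∧ A.IsSafety)
      (fun B : NBA Letter => B.IsGfM ∨ B.IsGfMCommitted) := by
  have hunamb : ∀ n : ℕ, 1 ≤ n → (autS n).IsStronglyUnambiguous := fun n hn =>
    (autS_isSeparating hn).isStronglyUnambiguous (autS_isSafety n)
  refine ⟨fun n hn => ⟨hunamb n hn, autS_isSeparating hn, autS_isSafety n, autS_language hn,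
    autS_numStates n, autS_numTransitions hn, fun B hB hL => NBA.two_pow_le_numStates hn hB hL⟩,
    1 / 4, by norm_num, ?_⟩
  -- With `n = (m - 2) / 2` there are `2 * n + 2 ≤ m` transitions, and `m ≤ 4 * n` once `m ≥ 6`;
  -- hence the constant `1 / 4`.
  filter_upwards [eventually_ge_atTop 6] with m hm
  have hn : 1 ≤ (m - 2) / 2 := by omega
  refine ⟨autS ((m - 2) / 2), ⟨hunamb _ hn, autS_isSeparating hn, autS_isSafety _⟩, ?_, ?_,
    fun B hB hL => ?_⟩
  · rw [autS_numStates]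
    omega
  · rw [autS_numTransitions hn]
    omega
  · rw [autS_language hn] at hL
    have h1 : (2 : ℝ) ^ ((m - 2) / 2) ≤ B.numStates := by
      exact_mod_cast NBA.two_pow_le_numStates hn hB hL
    refine le_trans ?_ h1
    rw [← Real.rpow_natCast]
    refine Real.rpow_le_rpow_of_exponent_le one_le_two ?_
    have h2 : (m : ℝ) ≤ 4 * (((m - 2) / 2 : ℕ) : ℝ) := by
      exact_mod_cast (by omega : m ≤ 4 * ((m - 2) / 2))
    linarith
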